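/- Let $\mathbb{Y}$ be a finite set with $|\mathbb{Y}|\ge 3$, and let $\mathcal P$ be the simplex $\Delta_{\mathbb Y}$ of probability distributions on $\mathbb{Y}$ (more generally, any set of distributions with $\Delta_{\mathbb Y}^{\circ}\subseteq\mathcal P\subseteq\Delta_{\mathbb Y}$, where $\Delta_{\mathbb Y}^{\circ}=\{p\in\Delta_{\mathbb Y}: p(y)>0\ \forall y\}$). Definitions. Let $d,m\ge 1$ be integers, $\hat{\mathcal R}\subseteq\mathbb R^d$ and $\hat\Gamma:\mathcal P\to\hat{\mathcal R}$. For $p\in\mathcal P$ let $\mathbb E_{p^m}$ denote the expectation over $y_1,\dots,y_m$ drawn i.i.d. from $p$. The property $\hat\Gamma$ is $m$-identifiable if there is $V:\hat{\mathcal R}\times\mathbb Y^m\to\mathbb R^d$ such that for all $p\in\mathcal P$ and $r\in\hat{\mathcal R}$: $\hat\Gamma(p)=r\iff\mathbb E_{p^m}[V(r,y_1,\dots,y_m)]=0$. A loss $\ell:\hat{\mathcal R}\times\mathbb Y^m\to\mathbb R$ directly elicits $\hat\Gamma$ if $\{\hat\Gamma(p)\}=\operatorname{argmin}_{r\in\hat{\mathcal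 R}}\mathbb E_{p^m}[\ell(r,y_1,\dots,y_m)]$ for all $p\in\mathcal P$. A function on $\mathcal P\subseteq\mathbb R^{\mathbb Y}$ is $C^\infty$ if it extends to a $C^\infty$ function on an open neighbourhood of $\mathcal P$. A property $\Gamma:\mathcal P\to\mathbb R$ is $C^\infty$ $(d,m)$-elicitable via the loss $\ell$ if there are a $C^\infty$, $m$-identifiable $\hat\Gamma:\mathcal P\to\hat{\mathcal R}$ directly elicited by $\ell$, and a link $\psi$ that is $C^\infty$ on an open neighbourhood of $\hat\Gamma(\mathcal P)$, with $\Gamma=\psi\circ\hat\Gamma$; it is $C^\infty$ $(d,m)$-elicitable if this holds for some $\hat{\mathcal R}\subseteq\mathbb R^d$ and some $\ell$. (Only $d,m\ge1$ are admissible; by convention nothing is $(d,m)$-elicitable if $d=0$ or $m=0$.) The $C^\infty$ elicitation frontier of $\Gamma$ is the set of $(d,m)$ such that $\Gamma$ is $C^\infty$ $(d,m)$-elicitable but neither $C^\infty$ $(d-1,m)$- nor $C^\infty$ $(d,m-1)$-elicitable; the $C^\infty$ observation complexity of $\Gamma$ is $m$ if $(1,m)$ lies on this frontier. Statement. For every integer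 $k\ge 1$, the $k$-norm $\Gamma(p)=\big(\sum_{y\in\mathbb Y}p(y)^k\big)^{1/k}$ satisfies: 1. $\Gamma$ is not $C^\infty$ $(1,k-1)$-elicitable. 2. $\Gamma$ is $C^\infty$ $(1,k)$-elicitable via the loss $\ell(r,y_1,\dots,y_k)=(r-\mathbf 1\{y_1=\cdots=y_k\})^2$ with report set $\hat{\mathcal R}=\mathbb R$. 3. The $C^\infty$ observation complexity of $\Gamma$ is exactly $k$: the pair $(1,k)$ lies on the $C^\infty$ elicitation frontier of $\Gamma$, and $k$ is the least $m$ such that $\Gamma$ is $C^\infty$ $(1,m)$-elicitable. -/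

import Mathlib

open scoped ContDiff

namespace Elicitation

noncomputable section

/-- The expectation of `f (y₁, …, yₘ)` when the observations `yᵢ` are drawn i.i.d. from the
distribution `p` on the finite set `Y`. -/
def expect {Y : Type*} [Fintype Y] {F : Type*} [AddCommGroup F] [Module ℝ F]
    (m : ℕ) (p : Y → ℝ) (f : (Fin m → Y) → F) : F :=
  ∑ y : Fin m → Y, (∏ i, p (y i)) • f y

/-- The `m`-observation loss `ℓ : R × Y^m → ℝ` directly elicits the property `Γ : P → R`:
for every `p ∈ P`, `Γ p` is the unique minimizer over `R` of the expected loss.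
(In particular `Γ p ∈ R`.) -/
def DirectlyElicits {Y : Type*} [Fintype Y] (P : Set (Y → ℝ)) {d : ℕ} (m : ℕ)
    (R : Set (Fin d → ℝ)) (ℓ : (Fin d → ℝ) → (Fin m → Y) → ℝ)
    (Γ : (Y → ℝ) → (Fin d → ℝ)) : Prop :=
  ∀ p ∈ P, {r | r ∈ R ∧ ∀ r' ∈ R, expect m p (ℓ r) ≤ expect m p (ℓ r')} = {Γ p}

/-- The property `Γ : P → R ⊆ ℝ^d` is identifiable with `m` observations. -/
def Identifiable {Y : Type*} [Fintype Y] (P : Set (Y → ℝ)) {d : ℕ} (m : ℕ)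
    (R : Set (Fin d → ℝ)) (Γ : (Y → ℝ) → (Fin d → ℝ)) : Prop :=
  ∃ V : (Fin d → ℝ) → (Fin m → Y) → (Fin d → ℝ),
    ∀ p ∈ P, ∀ r ∈ R, (Γ p = r ↔ expect m p (V r) = 0)

/-- `f` is `C^∞` on the (not necessarily open) set `P`: on `P` it agrees with a `C^∞` function
defined on an open neighbourhood of `P`. -/
def SmoothOn {E F : Type*} [NormedAddCommGroup E] [NormedSpace ℝ E]
    [NormedAddCommGroup F] [NormedSpace ℝ F] (P : Set E) (f : E → F) : Prop :=
  ∃ (U : Set E) (g : E → F), IsOpen U ∧ P ⊆ U ∧ ContDiffOn ℝ ∞ g U ∧ Set.EqOn f g P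

/-- The `m`-observation loss `ℓ` with report set `R ⊆ ℝ^d` indirectly elicits the property
`Γ : P → F` in the `C^∞` sense: there are a property `Γ' : P → R` that is `m`-identifiable,
`C^∞`, and directly elicited by `ℓ`, and a link function `ψ` that is `C^∞` on an open
neighbourhood of the image of `Γ'`, with `Γ = ψ ∘ Γ'` on `P`. (Hence `Γ` is `C^∞` as well.) -/
def SmoothElicitedBy {Y : Type*} [Fintype Y] {F : Type*} [NormedAddCommGroup F] [NormedSpace ℝ F]
    (P : Set (Y → ℝ)) (Γ : (Y → ℝ) → F) (d m : ℕ)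
    (R : Set (Fin d → ℝ)) (ℓ : (Fin d → ℝ) → (Fin m → Y) → ℝ) : Prop :=
  ∃ (Γ' : (Y → ℝ) → (Fin d → ℝ)) (ψ : (Fin d → ℝ) → F),
    Identifiable P m R Γ' ∧ DirectlyElicits P m R ℓ Γ' ∧ SmoothOn P Γ' ∧
    (∃ W : Set (Fin d → ℝ), IsOpen W ∧ Γ' '' P ⊆ W ∧ ContDiffOn ℝ ∞ ψ W) ∧
    ∀ p ∈ P, Γ p = ψ (Γ' p)

/-- `Γ : P → F` is `C^∞` `(d, m)`-elicitable. Report dimensions `d` and numbers of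
observations `m` are positive integers. -/
def SmoothElicitable {Y : Type*} [Fintype Y] {F : Type*} [NormedAddCommGroup F] [NormedSpace ℝ F]
    (P : Set (Y → ℝ)) (Γ : (Y → ℝ) → F) (d m : ℕ) : Prop :=
  1 ≤ d ∧ 1 ≤ m ∧ ∃ (R : Set (Fin d → ℝ)) (ℓ : (Fin d → ℝ) → (Fin m → Y) → ℝ),
    SmoothElicitedBy P Γ d m R ℓ

/-- The (`C^∞`) elicitation frontier: the pairs `(d, m)` such that `Γ` is `(d, m)`-elicitable but
neither `(d - 1, m)`- nor `(d, m - 1)`-elicitable. -/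
def smoothFrontier {Y : Type*} [Fintype Y] {F : Type*} [NormedAddCommGroup F] [NormedSpace ℝ F]
    (P : Set (Y → ℝ)) (Γ : (Y → ℝ) → F) : Set (ℕ × ℕ) :=
  {q | SmoothElicitable P Γ q.1 q.2 ∧ ¬ SmoothElicitable P Γ (q.1 - 1) q.2 ∧
    ¬ SmoothElicitable P Γ q.1 (q.2 - 1)}

/-- The `k`-norm of a distribution, `(∑ y, p(y)^k)^(1/k)`. -/
def kNorm {Y : Type*} [Fintype Y] (k : ℕ) (p : Y → ℝ) : ℝ :=
  (∑ y, p y ^ k) ^ (1 / (k : ℝ))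

/-- The loss `ℓ(r, y₁, …, yₖ) = (r - 1{y₁ = ⋯ = yₖ})²` with a one-dimensional report `r`. -/
def coincidenceLoss {Y : Type*} (k : ℕ) (r : Fin 1 → ℝ) (y : Fin k → Y) : ℝ :=
  (r 0 - Set.indicator {z : Fin k → Y | ∀ i j, z i = z j} (fun _ => (1 : ℝ)) y) ^ 2

end

end Elicitation

/-!
The upper bound is a computation: the event that `k` independent observations coincide has
probability `s = ∑ p(y)^k`, so the expected coincidence loss is `(r - s)²` plus a term that does
not involve `r`, and the `k`-norm is `s^(1/k)`, a smooth function of `s > 0`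
(`smoothElicitedBy_kNorm`).

For the lower bound (`not_smoothElicitable_kNorm`), suppose `m < k` observations suffice, with a
real-valued intermediate property `Γ'` and link `ψ`. A surjection `Y → Fin 3` embeds the open
triangle of distributions on three points into the simplex, and there `(k-norm)^k` becomes a
weighted power sum `∑ aᵢ xᵢ^k` with positive weights. As `Γ'` is a continuous real function on a
two-dimensional region, all its intermediate level sets are infinite; each lies in a level set
`∑ aᵢ xᵢ^k = c`, and `c` can be chosen outside any given finite set (`exists_infinite_fiber`).
Identifiability makes such a level set of `Γ'` the zero set in the triangle of a nonzero form `Q`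
of degree `m`.

On the other hand, since `∑ xᵢ = 1` on the triangle, the level set lies on the plane curve
`F = ∑ aᵢ Xᵢ^k - c (∑ Xᵢ)^k = 0`, which over `ℂ` is nonsingular for all but finitely many `c`
(`singularValues_finite`). A nonsingular plane curve is irreducible, because two components would
meet in a singular point (`irreducible_of_nonsingular`), and an irreducible curve of degree `k`
has only finitely many points in common with a curve of degree `m < k` (`finite_common_zeros`).
Both facts about intersections are obtained in the affine cone, from Krull's height theorem and the
dimension of the ring of polynomials in three variables.
-/

namespace Elicitation

open MvPolynomial

/-! ### Ideals of lines through the origin -/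

/-- The ideal of the line spanned by `v`, as the kernel of the restriction of polynomials to the
parametrized line `t ↦ t • v`. -/
noncomputable def lineIdeal {σ K : Type*} [Field K] (v : σ → K) : Ideal (MvPolynomial σ K) :=
  RingHom.ker (aeval (fun i => Polynomial.C (v i) * Polynomial.X) :
    MvPolynomial σ K →ₐ[K] Polynomial K)

instance lineIdeal_isPrime {σ K : Type*} [Field K] (v : σ → K) : (lineIdeal v).IsPrime :=
  RingHom.ker_isPrime _

/-- The maximal ideal of the origin. -/
noncomputable def originIdeal (σ K : Type*) [Field K] : Ideal (MvPolynomial σ K) :=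
  RingHom.ker (aeval (0 : σ → K) : MvPolynomial σ K →ₐ[K] K)

instance originIdeal_isPrime (σ K : Type*) [Field K] : (originIdeal σ K).IsPrime :=
  RingHom.ker_isPrime _

theorem mem_originIdeal {σ K : Type*} [Field K] {f : MvPolynomial σ K} :
    f ∈ originIdeal σ K ↔ eval 0 f = 0 := by
  simp [originIdeal, RingHom.mem_ker]

theorem eval_restrict_line {σ K : Type*} [Field K] (v : σ → K) (f : MvPolynomial σ K) (t : K) :
    (aeval (fun i => Polynomial.C (v i) * Polynomial.X) f : Polynomial K).eval t
      = eval (t • v) f := by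
  induction f using MvPolynomial.induction_on with
  | C a => simp
  | add p q hp hq => simp [hp, hq]
  | mul_X p i hp => simp [hp, mul_comm t]

theorem eval_smul_of_isHomogeneous {σ K : Type*} [Field K] {f : MvPolynomial σ K} {n : ℕ}
    (hf : f.IsHomogeneous n) (t : K) (v : σ → K) : eval (t • v) f = t ^ n * eval v f := by
  rw [eval_eq, eval_eq, Finset.mul_sum]
  refine Finset.sum_congr rfl fun d hd => ?_
  have hdeg := hf.degree_eq_sum_deg_support hd
  simp only [Pi.smul_apply, smul_eq_mul, mul_pow, Finset.prod_mul_distrib,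
    Finset.prod_pow_eq_pow_sum]
  rw [hdeg]
  ring

theorem restrict_line_of_isHomogeneous {σ K : Type*} [Field K] [Infinite K]
    {f : MvPolynomial σ K} {n : ℕ} (hf : f.IsHomogeneous n) (v : σ → K) :
    (aeval (fun i => Polynomial.C (v i) * Polynomial.X) f : Polynomial K)
      = Polynomial.C (eval v f) * Polynomial.X ^ n := by
  refine Polynomial.funext fun t => ?_
  rw [eval_restrict_line, eval_smul_of_isHomogeneous hf]
  rw [Polynomial.eval_mul, Polynomial.eval_C, Polynomial.eval_pow, Polynomial.eval_X, mul_comm]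

theorem mem_lineIdeal {σ K : Type*} [Field K] [Infinite K] {f : MvPolynomial σ K} {v : σ → K} :
    f ∈ lineIdeal v ↔ ∀ t : K, eval (t • v) f = 0 := by
  refine RingHom.mem_ker.trans ⟨fun h t => ?_, fun h => Polynomial.funext fun t => ?_⟩
  · rw [← eval_restrict_line, h, Polynomial.eval_zero]
  · rw [eval_restrict_line, h, Polynomial.eval_zero]

theorem mem_lineIdeal_of_isHomogeneous {σ K : Type*} [Field K] [Infinite K]
    {f : MvPolynomial σ K} {n : ℕ} (hf : f.IsHomogeneous n) {v : σ → K} (hv : eval v f = 0) :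
    f ∈ lineIdeal v :=
  mem_lineIdeal.2 fun t => by rw [eval_smul_of_isHomogeneous hf, hv, mul_zero]

theorem lineIdeal_lt_originIdeal {σ K : Type*} [Field K] {v : σ → K} (hv : v ≠ 0) :
    lineIdeal v < originIdeal σ K := by
  refine lt_of_le_not_ge (fun f hf => ?_) fun h => ?_
  · rw [mem_originIdeal, ← zero_smul K v, ← eval_restrict_line v f 0]
    have : (aeval (fun i => Polynomial.C (v i) * Polynomial.X) f : Polynomial K) = 0 := hf
    simp [this]
  · obtain ⟨i, hi⟩ := Function.ne_iff.1 hv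
    have : X i ∈ lineIdeal v := h (mem_originIdeal.2 (by simp))
    simp [lineIdeal, RingHom.mem_ker] at this
    exact hi this

/-- A point normalized to have coordinate sum `1` is determined by the line it spans. -/
theorem eq_of_lineIdeal_eq {K : Type*} [Field K] [Infinite K] {v w : Fin 3 → K}
    (hv : ∑ i, v i = 1) (hw : ∑ i, w i = 1) (h : lineIdeal v = lineIdeal w) : v = w := by
  funext i
  have hmem : (X i - C (v i) * ∑ j, X j : MvPolynomial (Fin 3) K) ∈ lineIdeal w := by
    rw [← h, mem_lineIdeal]
    intro t
    simp only [map_sub, map_mul, map_sum, eval_X, eval_C, Pi.smul_apply, smul_eq_mul,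
      ← Finset.mul_sum, hv]
    ring
  have := mem_lineIdeal.1 hmem 1
  simp only [map_sub, map_mul, map_sum, eval_X, eval_C, one_smul, hw, mul_one] at this
  exact (sub_eq_zero.1 this).symm

/-! ### Intersections of surfaces through the origin -/

theorem height_originIdeal_le (K : Type*) [Field K] : (originIdeal (Fin 3) K).height ≤ 3 := by
  have := Ideal.height_le_ringKrullDim_of_isPrime (I := originIdeal (Fin 3) K)
  simp only [MvPolynomial.ringKrullDim_of_isNoetherianRing, ringKrullDim_eq_zero_of_field,
    Nat.card_eq_fintype_card, Fintype.card_fin, zero_add] at this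
  exact WithBot.coe_le_coe.1 this

theorem three_le_height_originIdeal (K : Type*) [Field K] :
    3 ≤ (originIdeal (Fin 3) K).height := by
  have hp : (Ideal.span {(X 0 : MvPolynomial (Fin 3) K)}).IsPrime :=
    (Ideal.span_singleton_prime (X_ne_zero _)).2 (X_prime)
  have h1 : (⊥ : Ideal (MvPolynomial (Fin 3) K)) < Ideal.span {X 0} := by
    rw [bot_lt_iff_ne_bot, Ne, Ideal.span_singleton_eq_bot]
    exact X_ne_zero _
  have h2 : Ideal.span {(X 0 : MvPolynomial (Fin 3) K)} < lineIdeal (Pi.single 2 1) := by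
    refine lt_of_le_not_ge ?_ fun h => ?_
    · rw [Ideal.span_singleton_le_iff_mem, lineIdeal, RingHom.mem_ker]
      simp
    · have hX : (X 1 : MvPolynomial (Fin 3) K) ∈ lineIdeal (Pi.single 2 1 : Fin 3 → K) := by
        rw [lineIdeal, RingHom.mem_ker]
        simp
      have := h hX
      rw [Ideal.mem_span_singleton, X_dvd_X] at this
      simp at this
  have h3 : lineIdeal (Pi.single 2 1 : Fin 3 → K) < originIdeal (Fin 3) K :=
    lineIdeal_lt_originIdeal (by simp)
  have e1 := Ideal.height_add_one_le_of_lt_of_isPrime h1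
  have e2 := Ideal.height_add_one_le_of_lt_of_isPrime h2
  have e3 := Ideal.height_add_one_le_of_lt_of_isPrime h3
  calc (3 : ℕ∞) = 0 + 1 + 1 + 1 := by norm_num
    _ ≤ (⊥ : Ideal (MvPolynomial (Fin 3) K)).height + 1 + 1 + 1 := by gcongr; exact zero_le
    _ ≤ (Ideal.span {(X 0 : MvPolynomial (Fin 3) K)}).height + 1 + 1 := by gcongr
    _ ≤ (lineIdeal (Pi.single 2 1 : Fin 3 → K)).height + 1 := by gcongr
    _ ≤ _ := e3

/-- Two surfaces in affine `3`-space through the origin have a second common point: by Krull's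
height theorem the origin is not an isolated point of their intersection. -/
theorem exists_ne_zero_common_zero {K : Type*} [Field K] [IsAlgClosed K]
    {A B : MvPolynomial (Fin 3) K} (hA : eval 0 A = 0) (hB : eval 0 B = 0) :
    ∃ v : Fin 3 → K, v ≠ 0 ∧ eval v A = 0 ∧ eval v B = 0 := by
  classical
  have hle : Ideal.span (({A, B} : Finset (MvPolynomial (Fin 3) K)) : Set _)
      ≤ originIdeal (Fin 3) K := by
    rw [Ideal.span_le]
    intro f hf
    simp only [Finset.coe_insert, Finset.coe_singleton, Set.mem_insert_iff,
      Set.mem_singleton_iff] at hf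
    rcases hf with rfl | rfl <;> exact mem_originIdeal.2 ‹_›
  obtain ⟨q, hq, hqle⟩ := Ideal.exists_minimalPrimes_le hle
  have hqp : q.IsPrime := hq.1.1
  have hqh := Ideal.height_le_card_of_mem_minimalPrimes_span_finset hq
  -- The origin has height `3`, while `q` is minimal over an ideal with two generators.
  have hne : q ≠ originIdeal (Fin 3) K := by
    rintro rfl
    have h := (three_le_height_originIdeal K).trans (hqh.trans
      (Nat.cast_le.2 (Finset.card_le_two (a := A) (b := B))))
    norm_num at h
  by_contra! hcon
  -- If the origin were the only common zero, the Nullstellensatz would give `q = originIdeal`.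
  refine hne (le_antisymm hqle fun f hf => ?_)
  rw [← IsPrime.vanishingIdeal_zeroLocus (K := K) q, mem_vanishingIdeal_iff]
  intro v hv
  have hvA : eval v A = 0 := by
    simpa [aeval_eq_eval] using hv A (hq.1.2 (Ideal.subset_span (by simp)))
  have hvB : eval v B = 0 := by
    simpa [aeval_eq_eval] using hv B (hq.1.2 (Ideal.subset_span (by simp)))
  by_cases h0 : v = 0
  · subst h0
    simpa [aeval_eq_eval] using mem_originIdeal.1 hf
  · exact absurd hvB (hcon v h0 hvA)

/-! ### Plane curves -/

/-- A factor of a form that does not vanish at the origin is constant: on every line through the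
origin not contained in the zero set, the form restricts to a monomial `c * t ^ n`, whose divisors
that are nonzero at `t = 0` are constants. -/
theorem isUnit_of_mul_isHomogeneous {σ K : Type*} [Field K] [Infinite K]
    {A B : MvPolynomial σ K} {n : ℕ} (hAB : (A * B).IsHomogeneous n) (h0 : A * B ≠ 0)
    (hB : eval 0 B ≠ 0) : IsUnit B := by
  -- `A * B` vanishes wherever `B` differs from its value at the origin.
  have hzero : A * B * (B - C (eval 0 B)) = 0 := by
    refine MvPolynomial.funext fun x => ?_
    rw [map_mul, map_zero, map_sub, eval_C]
    by_cases hx : eval x (A * B) = 0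
    · simp [hx]
    have hr := restrict_line_of_isHomogeneous hAB x
    set b : Polynomial K := aeval (fun i => Polynomial.C (x i) * Polynomial.X) B with hb
    have hb0 : b.eval 0 = eval 0 B := by rw [hb, eval_restrict_line, zero_smul]
    have hb1 : b.eval 1 = eval x B := by rw [hb, eval_restrict_line, one_smul]
    have hdvd : b ∣ Polynomial.C (eval x (A * B)) * Polynomial.X ^ n := by
      rw [← hr, map_mul]
      exact dvd_mul_left _ _
    have hcop : IsCoprime b (Polynomial.X ^ n) := by
      refine IsCoprime.pow_right (IsCoprime.symm ?_)
      rw [Polynomial.irreducible_X.coprime_iff_not_dvd, Polynomial.X_dvd_iff,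
        Polynomial.coeff_zero_eq_eval_zero, hb0]
      exact hB
    have hunit : IsUnit b := isUnit_of_dvd_unit (hcop.dvd_of_dvd_mul_right hdvd)
      (Polynomial.isUnit_C.2 (IsUnit.mk0 _ hx))
    obtain ⟨c, -, hc⟩ := Polynomial.isUnit_iff.1 hunit
    have : eval x B = eval 0 B := by
      rw [← hb1, ← hb0, ← hc]
      simp
    simp [this]
  have hBC : B = C (eval 0 B) := sub_eq_zero.1 ((mul_eq_zero.1 hzero).resolve_left h0)
  rw [hBC]
  exact (IsUnit.mk0 _ hB).map C

/-- A ternary form of positive degree defining a nonsingular plane curve is irreducible: two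
proper factors would meet, and the product is singular at a common zero. -/
theorem irreducible_of_nonsingular {K : Type*} [Field K] [IsAlgClosed K]
    {F : MvPolynomial (Fin 3) K} {n : ℕ} (hF : F.IsHomogeneous n) (hn : n ≠ 0)
    (hsing : ∀ v, (∀ i, eval v (pderiv i F) = 0) → v = 0) : Irreducible F := by
  have hF0 : F ≠ 0 := by
    rintro rfl
    have := congrFun (hsing 1 (by simp)) 0
    simp at this
  have hFz : eval 0 F = 0 := by
    have := eval_smul_of_isHomogeneous hF 0 0
    simpa [hn] using this
  refine ⟨fun hu => ?_, fun A B hAB => ?_⟩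
  · have := hu.map (eval (0 : Fin 3 → K))
    rw [hFz] at this
    exact not_isUnit_zero this
  · by_cases hB : eval 0 B = 0
    · by_cases hA : eval 0 A = 0
      · obtain ⟨v, hv, hvA, hvB⟩ := exists_ne_zero_common_zero hA hB
        refine absurd (hsing v fun i => ?_) hv
        rw [hAB, Derivation.leibniz]
        simp [hvA, hvB]
      · left
        rw [hAB, mul_comm] at hF hF0
        exact isUnit_of_mul_isHomogeneous hF hF0 hA
    · right
      rw [hAB] at hF hF0
      exact isUnit_of_mul_isHomogeneous hF hF0 hB

/-- A weak form of Bézout's theorem: an irreducible plane curve meets a curve not containing it in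
finitely many points. Each common point spans a line whose ideal, for dimension reasons, is one of
the finitely many minimal primes over `(F, Q)`. Points are normalized to have coordinate sum
`1`. -/
theorem finite_common_zeros {K : Type*} [Field K] [Infinite K]
    {F Q : MvPolynomial (Fin 3) K} {n m : ℕ} (hF : F.IsHomogeneous n) (hQ : Q.IsHomogeneous m)
    (hirr : Irreducible F) (hdvd : ¬ F ∣ Q) :
    {v : Fin 3 → K | ∑ i, v i = 1 ∧ eval v F = 0 ∧ eval v Q = 0}.Finite := by
  refine Set.Finite.of_finite_image (f := lineIdeal)
    ((Ideal.finite_minimalPrimes_of_isNoetherianRing _ (Ideal.span {F, Q})).subset ?_)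
    fun v hv w hw h => eq_of_lineIdeal_eq hv.1 hw.1 h
  rintro _ ⟨v, ⟨hv1, hvF, hvQ⟩, rfl⟩
  have hv0 : v ≠ 0 := by
    rintro rfl
    simp at hv1
  have hle : Ideal.span {F, Q} ≤ lineIdeal v := by
    rw [Ideal.span_le]
    rintro f (rfl | rfl)
    · exact mem_lineIdeal_of_isHomogeneous hF hvF
    · exact mem_lineIdeal_of_isHomogeneous hQ hvQ
  obtain ⟨p, hp, hpv⟩ := Ideal.exists_minimalPrimes_le hle
  rcases eq_or_lt_of_le hpv with rfl | hlt
  · exact hp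
  exfalso
  have hpp : p.IsPrime := hp.1.1
  have hFp : (Ideal.span {F}).IsPrime :=
    (Ideal.span_singleton_prime hirr.ne_zero).2 hirr.prime
  have h1 : (⊥ : Ideal (MvPolynomial (Fin 3) K)) < Ideal.span {F} := by
    rw [bot_lt_iff_ne_bot, Ne, Ideal.span_singleton_eq_bot]
    exact hirr.ne_zero
  have h2 : Ideal.span {F} < p := by
    refine lt_of_le_not_ge ?_ fun h => hdvd ?_
    · rw [Ideal.span_singleton_le_iff_mem]
      exact hp.1.2 (Ideal.subset_span (by simp))
    · exact Ideal.mem_span_singleton.1 (h (hp.1.2 (Ideal.subset_span (by simp))))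
  have e1 := Ideal.height_add_one_le_of_lt_of_isPrime h1
  have e2 := Ideal.height_add_one_le_of_lt_of_isPrime h2
  have e3 := Ideal.height_add_one_le_of_lt_of_isPrime hlt
  have e4 := Ideal.height_add_one_le_of_lt_of_isPrime (lineIdeal_lt_originIdeal hv0)
  -- The chain `⊥ < (F) < p < line < origin` is too long for dimension `3`.
  have : (4 : ℕ∞) ≤ 3 := calc
    (4 : ℕ∞) = 0 + 1 + 1 + 1 + 1 := by norm_num
    _ ≤ (⊥ : Ideal (MvPolynomial (Fin 3) K)).height + 1 + 1 + 1 + 1 := by gcongr; exact zero_le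
    _ ≤ (Ideal.span {F}).height + 1 + 1 + 1 := by gcongr
    _ ≤ p.height + 1 + 1 := by gcongr
    _ ≤ (lineIdeal v).height + 1 := by gcongr
    _ ≤ _ := e4
    _ ≤ 3 := height_originIdeal_le K
  norm_num at this

theorem not_dvd_of_isHomogeneous_of_lt {σ K : Type*} [Field K] {F Q : MvPolynomial σ K} {n m : ℕ}
    (hF : F.IsHomogeneous n) (hQ : Q.IsHomogeneous m) (hmn : m < n) (hQ0 : Q ≠ 0) : ¬ F ∣ Q := by
  rintro ⟨G, rfl⟩
  have hF0 := left_ne_zero_of_mul hQ0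
  have h := hQ.totalDegree hQ0
  rw [totalDegree_mul_of_isDomain hF0 (right_ne_zero_of_mul hQ0), hF.totalDegree hF0] at h
  omega

/-! ### Weighted Fermat forms -/

/-- The weighted Fermat form `∑ aᵢ Xᵢ ^ k - c (∑ Xᵢ) ^ k`. -/
noncomputable def fermatForm (k : ℕ) (a : Fin 3 → ℂ) (c : ℂ) : MvPolynomial (Fin 3) ℂ :=
  ∑ i, C (a i) * X i ^ k - C c * (∑ i, X i) ^ k

theorem fermatForm_isHomogeneous (k : ℕ) (a : Fin 3 → ℂ) (c : ℂ) :
    (fermatForm k a c).IsHomogeneous k := by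
  refine IsHomogeneous.sub (IsHomogeneous.sum _ _ _ fun i _ => ?_) (IsHomogeneous.C_mul ?_ _)
  · exact isHomogeneous_C_mul_X_pow _ _ _
  · simpa using (IsHomogeneous.sum Finset.univ (fun i : Fin 3 => (X i : MvPolynomial (Fin 3) ℂ)) 1
      fun i _ => isHomogeneous_X _ _).pow k

theorem eval_fermatForm (k : ℕ) (a : Fin 3 → ℂ) (c : ℂ) (v : Fin 3 → ℂ) :
    eval v (fermatForm k a c) = ∑ i, a i * v i ^ k - c * (∑ i, v i) ^ k := by
  simp [fermatForm]

theorem eval_pderiv_fermatForm (k : ℕ) (a : Fin 3 → ℂ) (c : ℂ) (v : Fin 3 → ℂ) (i : Fin 3) :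
    eval v (pderiv i (fermatForm k a c))
      = k * (a i * v i ^ (k - 1) - c * (∑ j, v j) ^ (k - 1)) := by
  simp only [fermatForm, map_sub, map_sum, pderiv_C_mul, Derivation.leibniz_pow, pderiv_X]
  simp only [Pi.single_apply, smul_eq_mul, map_sum, map_mul, map_pow, eval_C, eval_X,
    nsmul_eq_mul, map_natCast, apply_ite (eval v), map_zero, mul_ite, mul_one, mul_zero,
    Finset.sum_ite_eq', Finset.mem_univ, if_true]
  ring

/-- The values `c` for which the curve `∑ aᵢ xᵢ ^ k = c (∑ xᵢ) ^ k` is singular. -/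
def singularValues (k : ℕ) (a : Fin 3 → ℂ) : Set ℂ :=
  {c | ∃ u : Fin 3 → ℂ, ∑ i, u i = 1 ∧ ∀ i, a i * u i ^ (k - 1) = c}

/-- Up to scaling, the coordinates of a singular point are roots of fixed polynomials, and `c` is
determined by the point. -/
theorem singularValues_finite {k : ℕ} (hk : 2 ≤ k) {a : Fin 3 → ℂ} (ha : ∀ i, a i ≠ 0) :
    (singularValues k a).Finite := by
  have hk1 : k - 1 ≠ 0 := by omega
  have hroots : ∀ i, {w : ℂ | w ^ (k - 1) = a 0 / a i}.Finite := fun i => by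
    refine (Polynomial.nthRootsFinset (k - 1) (a 0 / a i)).finite_toSet.subset fun w hw => ?_
    simpa [Polynomial.mem_nthRootsFinset (Nat.pos_of_ne_zero hk1)] using hw
  refine ((((hroots 1).prod (hroots 2)).image
    fun w : ℂ × ℂ => a 0 * (1 / (1 + w.1 + w.2)) ^ (k - 1)).insert 0).subset ?_
  rintro c ⟨u, hu, hc⟩
  by_cases h0 : u 0 = 0
  · left
    rw [← hc 0, h0, zero_pow hk1, mul_zero]
  right
  have hw : ∀ i, (u i / u 0) ^ (k - 1) = a 0 / a i := fun i => by
    rw [div_pow, div_eq_div_iff (pow_ne_zero _ h0) (ha i), mul_comm, hc i, hc 0]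
  refine ⟨(u 1 / u 0, u 2 / u 0), ⟨hw 1, hw 2⟩, ?_⟩
  have hsum : 1 / (1 + u 1 / u 0 + u 2 / u 0) = u 0 := by
    rw [Fin.sum_univ_three] at hu
    have : 1 + u 1 / u 0 + u 2 / u 0 = 1 / u 0 := by
      field_simp
      exact hu
    rw [this, one_div_one_div]
  simp only
  rw [hsum, hc 0]

theorem fermatForm_irreducible {k : ℕ} (hk : 2 ≤ k) {a : Fin 3 → ℂ} (ha : ∀ i, a i ≠ 0) {c : ℂ}
    (hc : c ∉ singularValues k a) : Irreducible (fermatForm k a c) := by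
  have hk1 : k - 1 ≠ 0 := by omega
  refine irreducible_of_nonsingular (fermatForm_isHomogeneous k a c) (by omega) fun v hv => ?_
  have hv' : ∀ i, a i * v i ^ (k - 1) = c * (∑ j, v j) ^ (k - 1) := fun i => by
    have := hv i
    rw [eval_pderiv_fermatForm, mul_eq_zero] at this
    exact sub_eq_zero.1 (this.resolve_left (by norm_cast; omega))
  by_cases hs : ∑ j, v j = 0
  · funext i
    have := hv' i
    rw [hs, zero_pow hk1, mul_zero, mul_eq_zero] at this
    exact pow_eq_zero_iff hk1 |>.1 (this.resolve_left (ha i))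
  · refine absurd ⟨fun i => v i / ∑ j, v j, ?_, fun i => ?_⟩ hc
    · rw [← Finset.sum_div, div_self hs]
    · rw [div_pow, ← mul_div_assoc, hv' i, mul_div_assoc, div_self (pow_ne_zero _ hs), mul_one]

/-! ### Infinite level sets on a triangle -/

/-- The relative interior of the triangle of probability distributions on three points. -/
def openTriangle : Set (Fin 3 → ℝ) :=
  {x | (∀ i, 0 < x i) ∧ ∑ i, x i = 1}

/-- For `u ∈ [0, 1]` a parabolic arc from the barycentre to a second point of the triangle, which
depends on `e` only; the bulge is governed by `t`. For `e ≠ 0`, arcs with different `t` meet only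
at their ends. -/
noncomputable def arc (e t u : ℝ) : Fin 3 → ℝ :=
  ![1 / 3 + e * u + t * (u * (1 - u)), 1 / 3 - e * u + t * (u * (1 - u)),
    1 / 3 - 2 * (t * (u * (1 - u)))]

theorem arc_mem {e t u : ℝ} (he : |e| ≤ 1 / 6) (ht : t ∈ Set.Icc (0 : ℝ) (1 / 2))
    (hu : u ∈ Set.Icc (0 : ℝ) 1) : arc e t u ∈ openTriangle := by
  obtain ⟨he1, he2⟩ := abs_le.1 he
  obtain ⟨ht1, ht2⟩ := ht
  obtain ⟨hu1, hu2⟩ := hu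
  have h1 : 0 ≤ u * (1 - u) := mul_nonneg hu1 (by linarith)
  have h2 : u * (1 - u) ≤ 1 / 4 := by nlinarith [sq_nonneg (u - 1 / 2)]
  have h3 : 0 ≤ t * (u * (1 - u)) := mul_nonneg ht1 h1
  have h4 : t * (u * (1 - u)) ≤ 1 / 2 * (1 / 4) := mul_le_mul ht2 h2 h1 (by norm_num)
  have h5 : e * u ≤ 1 / 6 := by nlinarith
  have h6 : -(1 / 6) ≤ e * u := by nlinarith
  refine ⟨fun i => ?_, ?_⟩
  · fin_cases i <;> simp [arc] <;> linarith
  · simp [arc, Fin.sum_univ_three]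
    ring

theorem continuous_arc (e t : ℝ) : Continuous (arc e t) := by
  refine continuous_pi fun i => ?_
  fin_cases i <;> simp [arc] <;> fun_prop

theorem arc_zero (e t : ℝ) : arc e t 0 = arc e 0 0 := by simp [arc]

theorem arc_one (e t : ℝ) : arc e t 1 = arc e 0 1 := by simp [arc]

theorem arc_inj {e t t' u u' : ℝ} (he : e ≠ 0) (hu0 : u ≠ 0) (hu1 : u ≠ 1)
    (h : arc e t u = arc e t' u') : t = t' := by
  have h0 := congrFun h 0
  have h2 := congrFun h 2
  simp [arc] at h0 h2
  have huu : u = u' := mul_left_cancel₀ he (by linarith)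
  rw [← huu] at h2
  simp only [mul_eq_mul_right_iff, mul_eq_zero] at h2
  rcases h2 with h2 | h2 | h2
  · exact h2
  · exact absurd h2 hu0
  · exact absurd (by linarith) hu1

/-- A positively weighted sum of `k`-th powers with `k ≥ 2` takes different values at the ends of
an arc, for one of the two signs of `e`, by strict convexity. -/
theorem exists_sum_pow_arc_ne {k : ℕ} (hk : 2 ≤ k) {a : Fin 3 → ℝ} (ha : ∀ i, 0 < a i) :
    ∃ e : ℝ, e ≠ 0 ∧ |e| ≤ 1 / 6 ∧
      ∑ i, a i * arc e 0 0 i ^ k ≠ ∑ i, a i * arc e 0 1 i ^ k := by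
  by_contra! h
  have h1 := h (1 / 6) (by norm_num) (by norm_num [abs_of_pos])
  have h2 := h (-(1 / 6)) (by norm_num) (by norm_num [abs_of_pos])
  simp [arc, Fin.sum_univ_three] at h1 h2
  have hc := (strictConvexOn_pow hk).2
    (show (3⁻¹ + 6⁻¹ : ℝ) ∈ Set.Ici 0 by norm_num) (show (3⁻¹ - 6⁻¹ : ℝ) ∈ Set.Ici 0 by norm_num)
    (by norm_num) (show (0 : ℝ) < 1 / 2 by norm_num) (show (0 : ℝ) < 1 / 2 by norm_num)
    (by norm_num)
  have hmid : (1 / 2 : ℝ) • (3⁻¹ + 6⁻¹ : ℝ) + (1 / 2 : ℝ) • (3⁻¹ - 6⁻¹ : ℝ) = 3⁻¹ := by norm_num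
  rw [hmid] at hc
  simp only [smul_eq_mul, inv_pow] at hc
  rw [← sub_eq_add_neg] at h2
  have h01 := add_pos (ha 0) (ha 1)
  nlinarith

/-- If the weighted power sum `∑ aᵢ xᵢ ^ k` factors on the triangle through a continuous real
function `f`, then some proper level set of `f` is infinite and lies over a value avoiding a given
finite set: a level between the values of `f` at the ends of the arcs is attained on each arc. -/
theorem exists_infinite_fiber {k : ℕ} (hk : 2 ≤ k) {a : Fin 3 → ℝ} (ha : ∀ i, 0 < a i)
    {f : (Fin 3 → ℝ) → ℝ} {h : ℝ → ℝ} (hf : ContinuousOn f openTriangle)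
    (hh : ContinuousOn h (f '' openTriangle))
    (hfac : ∀ x ∈ openTriangle, ∑ i, a i * x i ^ k = h (f x)) {B : Set ℝ} (hB : B.Finite) :
    ∃ x₀ ∈ openTriangle, ∃ x₁ ∈ openTriangle, ∃ c ∉ B, f x₁ ≠ f x₀ ∧
      {x | x ∈ openTriangle ∧ f x = f x₀ ∧ ∑ i, a i * x i ^ k = c}.Infinite := by
  obtain ⟨e, he0, he, hne⟩ := exists_sum_pow_arc_ne hk ha
  have hmem : ∀ t ∈ Set.Icc (0 : ℝ) (1 / 2), ∀ u ∈ Set.uIcc (0 : ℝ) 1,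
      arc e t u ∈ openTriangle := fun t ht u hu =>
    arc_mem he ht (by rwa [Set.uIcc_of_le zero_le_one] at hu)
  have h00 : (0 : ℝ) ∈ Set.Icc (0 : ℝ) (1 / 2) := by norm_num
  have hcont : ∀ t ∈ Set.Icc (0 : ℝ) (1 / 2),
      ContinuousOn (fun u => f (arc e t u)) (Set.uIcc 0 1) := fun t ht =>
    hf.comp (continuous_arc e t).continuousOn (hmem t ht)
  have harc : ∀ t ∈ Set.Icc (0 : ℝ) (1 / 2),
      Set.uIcc (f (arc e 0 0)) (f (arc e 0 1)) ⊆ (fun u => f (arc e t u)) '' Set.uIcc 0 1 :=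
    fun t ht => by
      have := intermediate_value_uIcc (hcont t ht)
      rwa [arc_zero, arc_one] at this
  have hsub : Set.uIcc (f (arc e 0 0)) (f (arc e 0 1)) ⊆ f '' openTriangle := fun s hs => by
    obtain ⟨u, hu, rfl⟩ := harc 0 h00 hs
    exact ⟨_, hmem 0 h00 u hu, rfl⟩
  rw [hfac _ (hmem 0 h00 0 Set.left_mem_uIcc), hfac _ (hmem 0 h00 1 Set.right_mem_uIcc)] at hne
  -- The value `c` lies strictly between the two end values, so `r` differs from `f` at both ends.
  obtain ⟨c, hc, hcB⟩ := (Set.Ioo_infinite (inf_lt_sup.2 hne)).exists_notMem_finite hB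
  obtain ⟨r, hr, hrc⟩ := intermediate_value_uIcc (hh.mono hsub) (Set.Ioo_subset_Icc_self hc)
  have hr0 : f (arc e 0 0) ≠ r := by
    rintro rfl
    rw [← hrc] at hc
    rcases le_total (h (f (arc e 0 0))) (h (f (arc e 0 1))) with hle | hle
    · rw [inf_of_le_left hle] at hc
      exact lt_irrefl _ hc.1
    · rw [sup_of_le_left hle] at hc
      exact lt_irrefl _ hc.2
  have hr1 : f (arc e 0 1) ≠ r := by
    rintro rfl
    rw [← hrc] at hc
    rcases le_total (h (f (arc e 0 0))) (h (f (arc e 0 1))) with hle | hle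
    · rw [sup_of_le_right hle] at hc
      exact lt_irrefl _ hc.2
    · rw [inf_of_le_right hle] at hc
      exact lt_irrefl _ hc.1
  obtain ⟨x₀, hx₀, rfl⟩ := hsub hr
  refine ⟨x₀, hx₀, _, hmem 0 h00 0 Set.left_mem_uIcc, c, hcB, hr0, ?_⟩
  choose! u hu hfu using fun t ht => harc t ht hr
  have hIoo := Set.Ioo_subset_Icc_self (a := (0 : ℝ)) (b := 1 / 2)
  refine Set.infinite_of_injOn_mapsTo (f := fun t => arc e t (u t)) (s := Set.Ioo (0 : ℝ) (1 / 2))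
    (fun t ht t' ht' htt => ?_) (fun t ht => ?_) (Set.Ioo_infinite (by norm_num))
  · have hft : f (arc e t (u t)) = f x₀ := hfu t (hIoo ht)
    refine arc_inj he0 (fun h0 => hr0 ?_) (fun h1 => hr1 ?_) htt
    · rwa [h0, arc_zero] at hft
    · rwa [h1, arc_one] at hft
  · have hft : f (arc e t (u t)) = f x₀ := hfu t (hIoo ht)
    exact ⟨hmem t (hIoo ht) _ (hu t (hIoo ht)), hft,
      by rw [hfac _ (hmem t (hIoo ht) _ (hu t (hIoo ht))), hft, hrc]⟩

/-! ### The triangle inside the simplex of distributions -/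

theorem kNorm_pow {Y : Type*} [Fintype Y] {k : ℕ} (hk : k ≠ 0) {p : Y → ℝ} (hp : ∀ y, 0 ≤ p y) :
    kNorm k p ^ k = ∑ y, p y ^ k := by
  rw [kNorm, one_div,
    Real.rpow_inv_natCast_pow (Finset.sum_nonneg fun y _ => pow_nonneg (hp y) k) hk]

/-- The number of elements of the fibre of `π` over `i`. -/
noncomputable def fiberCard {Y : Type*} [Fintype Y] (π : Y → Fin 3) (i : Fin 3) : ℝ :=
  ((Finset.univ.filter fun y => π y = i).card : ℝ)

/-- The distribution on `Y` whose push-forward along `π` is `x` and which is uniform on each fibre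
of `π`. -/
noncomputable def spread {Y : Type*} [Fintype Y] (π : Y → Fin 3) (x : Fin 3 → ℝ) (y : Y) : ℝ :=
  x (π y) / fiberCard π (π y)

section Spread

variable {Y : Type*} [Fintype Y] {π : Y → Fin 3}

theorem fiberCard_pos (hπ : Function.Surjective π) (i : Fin 3) : 0 < fiberCard π i := by
  obtain ⟨y, hy⟩ := hπ i
  exact Nat.cast_pos.2 (Finset.card_pos.2 ⟨y, by simp [hy]⟩)

theorem sum_comp_eq_sum_fiberCard_mul (π : Y → Fin 3) (φ : Fin 3 → ℝ) :
    ∑ y, φ (π y) = ∑ i, fiberCard π i * φ i := by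
  rw [← Finset.sum_fiberwise Finset.univ π]
  refine Finset.sum_congr rfl fun i _ => ?_
  rw [Finset.sum_congr rfl (g := fun _ => φ i) fun y hy => by rw [(Finset.mem_filter.1 hy).2],
    Finset.sum_const, nsmul_eq_mul, fiberCard]

theorem sum_spread_pow (π : Y → Fin 3) (x : Fin 3 → ℝ) (k : ℕ) :
    ∑ y, spread π x y ^ k = ∑ i, fiberCard π i / fiberCard π i ^ k * x i ^ k := by
  refine (sum_comp_eq_sum_fiberCard_mul π fun i => (x i / fiberCard π i) ^ k).trans ?_
  refine Finset.sum_congr rfl fun i _ => ?_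
  rw [div_pow]
  ring

theorem spread_pos (hπ : Function.Surjective π) {x : Fin 3 → ℝ} (hx : x ∈ openTriangle) (y : Y) :
    0 < spread π x y :=
  div_pos (hx.1 _) (fiberCard_pos hπ _)

theorem spread_mem_stdSimplex (hπ : Function.Surjective π) {x : Fin 3 → ℝ}
    (hx : x ∈ openTriangle) : spread π x ∈ stdSimplex ℝ Y := by
  refine ⟨fun y => (spread_pos hπ hx y).le, ?_⟩
  have := sum_spread_pow π x 1
  simp only [pow_one] at this
  rw [this, ← hx.2]
  exact Finset.sum_congr rfl fun i _ => by rw [div_self (fiberCard_pos hπ i).ne', one_mul]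

theorem continuous_spread (π : Y → Fin 3) : Continuous (spread π) :=
  continuous_pi fun y => (continuous_apply (π y)).div_const _

/-- The expectation of `v` under `spread π x`, as a polynomial in `x`. -/
noncomputable def expectForm (π : Y → Fin 3) {m : ℕ} (v : (Fin m → Y) → ℝ) :
    MvPolynomial (Fin 3) ℂ :=
  ∑ y : Fin m → Y, C (v y : ℂ) * ∏ i, (C ((fiberCard π (π (y i)) : ℂ)⁻¹) * X (π (y i)))

theorem expectForm_isHomogeneous (π : Y → Fin 3) {m : ℕ} (v : (Fin m → Y) → ℝ) :
    (expectForm π v).IsHomogeneous m := by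
  refine IsHomogeneous.sum _ _ _ fun y _ => IsHomogeneous.C_mul ?_ _
  simpa using IsHomogeneous.prod Finset.univ
    (fun i => (C ((fiberCard π (π (y i)) : ℂ)⁻¹) * X (π (y i)) : MvPolynomial (Fin 3) ℂ))
    (fun _ => 1) fun i _ => isHomogeneous_C_mul_X _ _

theorem eval_expectForm (π : Y → Fin 3) {m : ℕ} (v : (Fin m → Y) → ℝ) (x : Fin 3 → ℝ) :
    eval (fun i => (x i : ℂ)) (expectForm π v) = (expect m (spread π x) v : ℝ) := by
  simp only [expectForm, expect, spread, map_sum, map_mul, map_prod, eval_C, eval_X, smul_eq_mul,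
    Complex.ofReal_sum, Complex.ofReal_mul, Complex.ofReal_prod, Complex.ofReal_div]
  refine Finset.sum_congr rfl fun y _ => ?_
  rw [mul_comm]
  congr 1
  exact Finset.prod_congr rfl fun i _ => by rw [div_eq_mul_inv, mul_comm]

end Spread

/-! ### Too few observations -/

theorem expect_apply {Y ι : Type*} [Fintype Y] (m : ℕ) (p : Y → ℝ) (v : (Fin m → Y) → ι → ℝ)
    (j : ι) : expect m p v j = expect m p fun y => v y j := by
  simp [expect, Finset.sum_apply]

/-- With fewer than `k` observations the level sets of an identifiable property are zero sets of
forms of degree less than `k`; those cannot contain infinitely many points of an irreducible curve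
of degree `k` in a triangle of distributions. -/
theorem not_smoothElicitable_kNorm {Y : Type*} [Fintype Y] (hY : 3 ≤ Fintype.card Y)
    {P : Set (Y → ℝ)} (hP' : {p | p ∈ stdSimplex ℝ Y ∧ ∀ y, 0 < p y} ⊆ P) {k m : ℕ}
    (hmk : m < k) : ¬ SmoothElicitable P (kNorm k) 1 m := by
  rintro ⟨-, hm, R, ℓ, Γ, ψ, ⟨V, hV⟩, hdir, ⟨U, G, -, hPU, hG, hΓG⟩, ⟨W, -, hW, hψ⟩, hlink⟩
  have hk : 2 ≤ k := by omega
  obtain ⟨e⟩ : Nonempty (Fin 3 ↪ Y) :=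
    Function.Embedding.nonempty_of_card_le (by simpa using hY)
  -- Any surjection onto three points embeds the triangle into the full-support distributions.
  set π : Y → Fin 3 := Function.invFun e
  have hπ : Function.Surjective π := Function.invFun_surjective e.injective
  have hN := fiberCard_pos hπ
  set a : Fin 3 → ℝ := fun i => fiberCard π i / fiberCard π i ^ k
  have ha : ∀ i, 0 < a i := fun i => div_pos (hN i) (pow_pos (hN i) k)
  have hTP : ∀ x ∈ openTriangle, spread π x ∈ P := fun x hx =>
    hP' ⟨spread_mem_stdSimplex hπ hx, spread_pos hπ hx⟩
  have hΓR : ∀ p ∈ P, Γ p ∈ R := fun p hp =>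
    ((hdir p hp).symm.subset (Set.mem_singleton _)).1
  have hconst : ∀ r : Fin 1 → ℝ, (fun _ => r 0) = r := fun r =>
    funext fun i => congrArg r (Subsingleton.elim _ _)
  have hΓcont : ContinuousOn Γ P := (hG.continuousOn.mono hPU).congr hΓG
  have hf : ContinuousOn (fun x => Γ (spread π x) 0) openTriangle :=
    (continuous_apply 0).comp_continuousOn
      (hΓcont.comp (continuous_spread π).continuousOn hTP)
  have hh : ContinuousOn (fun s : ℝ => ψ (fun _ => s) ^ k)
      ((fun x => Γ (spread π x) 0) '' openTriangle) := by
    refine ContinuousOn.pow (hψ.continuousOn.comp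
      (continuous_pi fun _ => continuous_id).continuousOn ?_) k
    rintro _ ⟨x, hx, rfl⟩
    change (fun _ => Γ (spread π x) 0) ∈ W
    rw [hconst]
    exact hW ⟨_, hTP x hx, rfl⟩
  have hfac : ∀ x ∈ openTriangle,
      ∑ i, a i * x i ^ k = ψ (fun _ => Γ (spread π x) 0) ^ k := fun x hx => by
    rw [hconst, ← hlink _ (hTP x hx), kNorm_pow (by omega) fun y => (spread_pos hπ hx y).le,
      sum_spread_pow π]
  have haC : ∀ i, (a i : ℂ) ≠ 0 := fun i => Complex.ofReal_ne_zero.2 (ha i).ne'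
  obtain ⟨x₀, hx₀, x₁, hx₁, c, hc, hne, hinf⟩ := exists_infinite_fiber hk ha hf hh hfac
    ((singularValues_finite hk haC).preimage (f := ((↑) : ℝ → ℂ)) Complex.ofReal_injective.injOn)
  -- `Q` cuts out the level set of `Γ` through `spread π x₀` inside the triangle.
  set Q := expectForm π fun y => V (Γ (spread π x₀)) y 0 with hQ_def
  have hQ : ∀ x ∈ openTriangle, eval (fun i => (x i : ℂ)) Q = 0 ↔
      Γ (spread π x) 0 = Γ (spread π x₀) 0 := fun x hx => by
    rw [hQ_def, eval_expectForm, Complex.ofReal_eq_zero, ← expect_apply]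
    have hid := hV _ (hTP x hx) _ (hΓR _ (hTP x₀ hx₀))
    refine ⟨fun h => ?_, fun h => ?_⟩
    · rw [hid.2 ((hconst _).symm.trans (funext fun _ => h))]
    · rw [hid.1 (by rw [← hconst (Γ (spread π x)), h, hconst])]
      rfl
  have hQ0 : Q ≠ 0 := fun h => hne ((hQ x₁ hx₁).1 (by rw [h, map_zero]))
  have hfin := finite_common_zeros (fermatForm_isHomogeneous k _ _)
    (expectForm_isHomogeneous π _) (fermatForm_irreducible hk haC hc)
    (not_dvd_of_isHomogeneous_of_lt (fermatForm_isHomogeneous k _ _)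
      (expectForm_isHomogeneous π _) hmk hQ0)
  refine hinf ((hfin.preimage (f := fun (x : Fin 3 → ℝ) i => (x i : ℂ))
    fun x _ x' _ h => funext fun i => Complex.ofReal_injective (congrFun h i)).subset ?_)
  rintro x ⟨hx, hfx, hxc⟩
  have hsum : ∑ i, (x i : ℂ) = 1 := by exact_mod_cast hx.2
  refine ⟨hsum, ?_, (hQ x hx).2 hfx⟩
  rw [eval_fermatForm, hsum, one_pow, mul_one, sub_eq_zero]
  beta_reduce
  exact_mod_cast hxc

/-! ### The coincidence loss -/

section Coincidence

variable {Y : Type*}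

/-- The indicator of the event that all observations coincide. -/
noncomputable def coincidence (k : ℕ) : (Fin k → Y) → ℝ :=
  Set.indicator {z : Fin k → Y | ∀ i j, z i = z j} fun _ => 1

theorem coincidence_of_forall {k : ℕ} {z : Fin k → Y} (hz : ∀ i j, z i = z j) :
    coincidence k z = 1 :=
  Set.indicator_of_mem (s := {z : Fin k → Y | ∀ i j, z i = z j}) hz _

theorem coincidence_of_not_forall {k : ℕ} {z : Fin k → Y} (hz : ¬ ∀ i j, z i = z j) :
    coincidence k z = 0 :=
  Set.indicator_of_notMem (s := {z : Fin k → Y | ∀ i j, z i = z j}) hz _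

variable [Fintype Y]

theorem expect_one {p : Y → ℝ} (hp : ∑ y, p y = 1) (k : ℕ) :
    expect k p (fun _ => (1 : ℝ)) = 1 := by
  simp only [expect, smul_eq_mul, mul_one]
  rw [← Fintype.sum_pow, hp, one_pow]

theorem expect_coincidence {k : ℕ} (hk : 1 ≤ k) (p : Y → ℝ) :
    expect k p (coincidence k) = ∑ y, p y ^ k := by
  classical
  have hind : ∀ z : Fin k → Y, coincidence k z = ∑ y, if z = fun _ => y then 1 else 0 := by
    intro z
    by_cases hz : ∀ i j, z i = z j
    · have hz' : ∀ y, (z = fun _ => y) ↔ y = z ⟨0, hk⟩ := fun y =>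
        ⟨fun h => by rw [h], fun h => funext fun i => by rw [h, hz i]⟩
      simp [coincidence_of_forall hz, hz']
    · rw [coincidence_of_not_forall hz, Finset.sum_eq_zero]
      intro y _
      rw [if_neg]
      rintro rfl
      exact hz fun _ _ => rfl
  simp only [expect, smul_eq_mul, hind, Finset.mul_sum]
  rw [Finset.sum_comm]
  simp

theorem expect_sub_coincidence {k : ℕ} (hk : 1 ≤ k) {p : Y → ℝ} (hp : ∑ y, p y = 1) (r : ℝ) :
    expect k p (fun z => r - coincidence k z) = r - ∑ y, p y ^ k := by
  have h1 := expect_one hp k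
  have h2 := expect_coincidence hk p
  simp only [expect, smul_eq_mul] at h1 h2 ⊢
  simp only [mul_sub, Finset.sum_sub_distrib, ← Finset.sum_mul, mul_one] at h1 ⊢
  rw [h1, h2, one_mul]

theorem expect_coincidenceLoss {k : ℕ} (hk : 1 ≤ k) {p : Y → ℝ} (hp : ∑ y, p y = 1)
    (r : Fin 1 → ℝ) : expect k p (coincidenceLoss k r)
      = (r 0 - ∑ y, p y ^ k) ^ 2 + ((∑ y, p y ^ k) - (∑ y, p y ^ k) ^ 2) := by
  have hsq : ∀ z : Fin k → Y, coincidenceLoss k r z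
      = r 0 ^ 2 + (1 - 2 * r 0) * coincidence k z := fun z => by
    change (r 0 - coincidence k z) ^ 2 = _
    by_cases hz : ∀ i j, z i = z j
    · rw [coincidence_of_forall hz]
      ring
    · rw [coincidence_of_not_forall hz]
      ring
  have h1 := expect_one hp k
  have h2 := expect_coincidence hk p
  simp only [expect, smul_eq_mul, mul_one] at h1 h2 ⊢
  simp only [hsq, mul_add, Finset.sum_add_distrib, mul_left_comm _ (1 - 2 * r 0),
    ← Finset.mul_sum, ← Finset.sum_mul]
  rw [h1, h2]
  ring

end Coincidence

theorem smoothElicitedBy_kNorm {Y : Type*} [Fintype Y] {P : Set (Y → ℝ)}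
    (hP : P ⊆ stdSimplex ℝ Y) {k : ℕ} (hk : 1 ≤ k) :
    SmoothElicitedBy P (kNorm k) 1 k Set.univ (coincidenceLoss k) := by
  have hext : ∀ (p : Y → ℝ) (r : Fin 1 → ℝ), (fun _ => ∑ y, p y ^ k) = r ↔ r 0 - ∑ y, p y ^ k = 0 :=
    fun p r => ⟨fun h => by rw [← h, sub_self], fun h => funext fun i => by
      rw [Subsingleton.elim i 0, sub_eq_zero.1 h]⟩
  refine ⟨fun p _ => ∑ y, p y ^ k, fun r => r 0 ^ (1 / (k : ℝ)),
    ⟨fun r z _ => r 0 - coincidence k z, fun p hp r _ => ?_⟩, fun p hp => ?_,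
    ⟨Set.univ, fun p _ => ∑ y, p y ^ k, isOpen_univ, Set.subset_univ _, ?_, fun _ _ => rfl⟩,
    ⟨{r | 0 < r 0}, isOpen_lt continuous_const (continuous_apply 0), ?_, ?_⟩, fun p _ => rfl⟩
  · rw [hext, ← expect_sub_coincidence hk (hP hp).2]
    refine ⟨fun h => funext fun j => ?_, fun h => ?_⟩
    · rw [expect_apply]
      exact h
    · have := congrFun h 0
      rwa [expect_apply] at this
  · ext r
    simp only [Set.mem_univ, true_and, forall_const, Set.mem_ofPred_eq, Set.mem_singleton_iff,
      expect_coincidenceLoss hk (hP hp).2, add_le_add_iff_right]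
    rw [eq_comm, hext]
    refine ⟨fun h => ?_, fun h r' => ?_⟩
    · have := h fun _ => ∑ y, p y ^ k
      rw [sub_self] at this
      nlinarith
    · rw [h]
      nlinarith [sq_nonneg (r' 0 - ∑ y, p y ^ k)]
  · exact ContDiff.contDiffOn (by fun_prop)
  · rintro _ ⟨p, hp, rfl⟩
    obtain ⟨hp0, hp1⟩ := hP hp
    obtain ⟨y, -, hy⟩ : ∃ y ∈ Finset.univ, 0 < p y := by
      by_contra! h
      have := Finset.sum_nonpos h
      linarith
    exact Finset.sum_pos' (fun y _ => pow_nonneg (hp0 y) k) ⟨y, Finset.mem_univ _, pow_pos hy k⟩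
  · exact ContDiffOn.rpow_const_of_ne (by fun_prop) fun r hr => ne_of_gt (Set.mem_ofPred.1 hr)

end Elicitation

theorem mainTheorem3 {Y : Type*} [Fintype Y] (hY : 3 ≤ Fintype.card Y)
    (P : Set (Y → ℝ)) (hP : P ⊆ stdSimplex ℝ Y)
    (hP' : {p | p ∈ stdSimplex ℝ Y ∧ ∀ y, 0 < p y} ⊆ P)
    (k : ℕ) (hk : 1 ≤ k) :
    ¬ Elicitation.SmoothElicitable P (Elicitation.kNorm k) 1 (k - 1) ∧
    Elicitation.SmoothElicitedBy P (Elicitation.kNorm k) 1 k Set.univ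
      (Elicitation.coincidenceLoss k) ∧
    (1, k) ∈ Elicitation.smoothFrontier P (Elicitation.kNorm k) ∧
    IsLeast {m | Elicitation.SmoothElicitable P (Elicitation.kNorm k) 1 m} k := by
  have hlow : ∀ m, m < k → ¬ Elicitation.SmoothElicitable P (Elicitation.kNorm k) 1 m :=
    fun m hm => Elicitation.not_smoothElicitable_kNorm hY hP' hm
  have hby := Elicitation.smoothElicitedBy_kNorm hP hk
  have hel : Elicitation.SmoothElicitable P (Elicitation.kNorm k) 1 k :=
    ⟨le_rfl, hk, _, _, hby⟩
  exact ⟨hlow _ (by omega), hby, ⟨hel, fun h => absurd h.1 (by norm_num), hlow _ (by simp; omega)⟩,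
    hel, fun m hm => not_lt.1 fun h => hlow m h hm⟩
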